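/- Let $V$ be a finite set of spins-$1/2$ and let $H=\sum_{\{a,b\}\subset V}h_{a,b}$ be a Hamiltonian on $(\mathbb C^2)^{\otimes V}$ whose terms $h_{a,b}$ act on pairs of spins and have ground energy zero, i.e. $h_{a,b}\ge 0$ and $\ker h_{a,b}\neq 0$. The interaction graph of $H$ has vertex set $V$ and an edge $ab$ for each non-zero term $h_{a,b}$. Assume that $H$ is natural, i.e. its interaction graph is connected and for every non-zero term $h_{a,b}$ there is an entangled (non-product) vector of $\mathbb C^2\otimes\mathbb C^2$ orthogonal to $\ker h_{a,b}$; and that $H$ is frustration-free, i.e. every vector $\Phi$ of the ground space $M$ of $H$ (the eigenspace of its least eigenvalue) satisfies $h_{a,b}\Phi=0$ for all $a,b$. Let $A\subset V$ be contiguous, i.e. the subgraph $G_A$ of the interaction graph induced on $A$ is connected, and let $H_A=\sum_{\{a,b\}\subset A}h_{a,b}$, acting on $(\mathbb C^2)^{\otimes A}$. Call an edge of $G_A$ heavy if its term has rank $2$ or $3$, and suppose that the graph on the vertex set $A$ formed by the heavy edges of $G_A$ has at most $\beta$ connected components. Let $M_A\subset(\mathbb C^2)^{\otimes A}$ be the span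 of the supports of the reduced states $\operatorname{tr}_{V\setminus A}|\Phi\rangle\langle\Phi|$, $\Phi\in M$. Then $$\log_2\dim\ker H_A\le\log_2(\beta+1),\qquad \log_2\dim M_A\le\log_2(\beta+1).$$ Moreover every non-zero $\Phi\in M$ has Schmidt measure ($\log_2$ of its Schmidt rank) at most $\log_2(\beta+1)$ across the cut $A\,|\,V\setminus A$, and for every density operator $\rho$ supported on $M$ and every $C\subset V$ disjoint from $A$, the entanglement of formation between $A$ and $C$ of the reduced state of $\rho$ on $A\cup C$ is at most $\log_2(\beta+1)$ e-bits. In particular, if all non-zero terms of $H$ have rank $2$ or $3$, then all these quantities are at most $1$: there is at most one e-bit of entanglement between a contiguous subsystem $A$ and the rest of the system, or any other subsystem disjoint from $A$. -/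

import Mathlib

open scoped ComplexOrder

noncomputable section

/-- A two-spin vector `ψ ∈ ℂ² ⊗ ℂ²` is entangled if it is not a product vector. -/
def IsEntangled (ψ : Fin 2 × Fin 2 → ℂ) : Prop :=
  ¬ ∃ α β : Fin 2 → ℂ, ∀ i j, ψ (i, j) = α i * β j

/-- The operator on `(ℂ²)^{⊗ V}` that acts as the two-spin operator `M` on the spins `a`, `b`
(first factor on `a`, second factor on `b`, where `a ≠ b`) and as the identity elsewhere. -/
def embedPair {V : Type*} [Fintype V] [DecidableEq V] (a b : V)
    (M : Matrix (Fin 2 × Fin 2) (Fin 2 × Fin 2) ℂ) : Matrix (V → Fin 2) (V → Fin 2) ℂ :=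
  fun x y => if ∀ c, c ≠ a → c ≠ b → x c = y c then M (x a, x b) (y a, y b) else 0

/-- The two-spin terms of a Hamiltonian `∑_{a,b} h_{a,b}` (sum over unordered pairs) on the set
of spins `V`. The operator `h_{a,b}` is written with the tensor factors in the order `a, b`, so
that `h_{b,a}` is the same operator with the two factors exchanged. -/
structure PairHamiltonian (V : Type*) where
  term : V → V → Matrix (Fin 2 × Fin 2) (Fin 2 × Fin 2) ℂ
  term_self : ∀ a, term a a = 0
  term_symm : ∀ a b, term b a = (term a b).submatrix Prod.swap Prod.swap

namespace PairHamiltonian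

variable {V : Type*}

/-- The Hamiltonian `H_A` of all terms internal to `A`, on the spins of `A`. -/
def restrict (H : PairHamiltonian V) (A : Finset V) : PairHamiltonian A where
  term a b := H.term a b
  term_self a := H.term_self a
  term_symm a b := H.term_symm a b

theorem embedPair_term_comm [Fintype V] [DecidableEq V] (H : PairHamiltonian V) (a b : V) :
    embedPair a b (H.term a b) = embedPair b a (H.term b a) := by
  ext x y
  rw [H.term_symm a b]
  simp only [embedPair, Matrix.submatrix_apply, Prod.swap_prod_mk]
  congr 1
  exact propext ⟨fun h c hb ha => h c ha hb, fun h c ha hb => h c hb ha⟩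

/-- The operator `H = ∑_{a,b} h_{a,b}` on `(ℂ²)^{⊗ V}`, each unordered pair counted once. -/
def op [Fintype V] [DecidableEq V] (H : PairHamiltonian V) : Matrix (V → Fin 2) (V → Fin 2) ℂ :=
  ∑ e : Sym2 V,
    Sym2.lift ⟨fun a b => embedPair a b (H.term a b), H.embedPair_term_comm⟩ e

/-- The interaction graph: an edge for each non-zero term. -/
def interactionGraph (H : PairHamiltonian V) : SimpleGraph V where
  Adj a b := H.term a b ≠ 0
  symm := ⟨by
    intro a b h h0
    apply h
    rw [H.term_symm b a, h0]
    rfl⟩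
  loopless := ⟨fun a h => h (H.term_self a)⟩

theorem rank_term_comm (H : PairHamiltonian V) (a b : V) :
    (H.term b a).rank = (H.term a b).rank := by
  rw [H.term_symm a b]
  exact Matrix.rank_submatrix (H.term a b) (Equiv.prodComm _ _) (Equiv.prodComm _ _)

/-- The subgraph of heavy edges: those whose term has rank `2` or `3`. -/
def heavyGraph (H : PairHamiltonian V) : SimpleGraph V where
  Adj a b := (H.term a b).rank = 2 ∨ (H.term a b).rank = 3
  symm := ⟨by
    intro a b h
    rwa [H.rank_term_comm a b]⟩
  loopless := ⟨by
    intro a h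
    simp [H.term_self a] at h⟩

/-- Natural Hamiltonians: each term has ground energy zero, there are no isolated subsystems, and
each (non-zero) term has an entangled excited state, that is an entangled vector orthogonal to its
ground space. -/
structure IsNatural (H : PairHamiltonian V) : Prop where
  posSemidef : ∀ a b, (H.term a b).PosSemidef
  ground_energy_zero : ∀ a b, ∃ φ : Fin 2 × Fin 2 → ℂ, φ ≠ 0 ∧ (H.term a b).mulVec φ = 0
  not_isolated : H.interactionGraph.Preconnected
  entangled_excited : ∀ a b, H.term a b ≠ 0 →
    ∃ ψ : Fin 2 × Fin 2 → ℂ, IsEntangled ψ ∧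
      ∀ φ, (H.term a b).mulVec φ = 0 → star φ ⬝ᵥ ψ = 0

/-- The least eigenvalue of a Hermitian matrix. -/
def groundEnergy {n : Type*} [Fintype n] (M : Matrix n n ℂ) : ℝ :=
  sInf {E : ℝ | ∃ Φ : n → ℂ, Φ ≠ 0 ∧ M.mulVec Φ = (E : ℂ) • Φ}

/-- The ground state manifold: the eigenspace of the least eigenvalue of `H`. -/
def groundSpace [Fintype V] [DecidableEq V] (H : PairHamiltonian V) :
    Submodule ℂ ((V → Fin 2) → ℂ) :=
  LinearMap.ker (H.op.mulVecLin - (groundEnergy H.op : ℂ) • LinearMap.id)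

/-- Every ground state vector of `H` is annihilated by every term, i.e. is a ground state of each
of the terms (whose ground energies are zero). -/
def IsFrustrationFree [Fintype V] [DecidableEq V] (H : PairHamiltonian V) : Prop :=
  ∀ Φ ∈ H.groundSpace, ∀ a b, (embedPair a b (H.term a b)).mulVec Φ = 0

/-- Any two spins of `A` are joined by a path of interaction edges inside `A`. -/
def IsContiguous (H : PairHamiltonian V) (A : Finset V) : Prop :=
  (H.restrict A).interactionGraph.Preconnected

/-- The number of connected components of the heavy subgraph of the interaction graph of `H_A`
(a spin of `A` without heavy edges inside `A` is a component by itself). -/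
def heavyComponents (H : PairHamiltonian V) (A : Finset V) : ℕ :=
  Nat.card (H.restrict A).heavyGraph.ConnectedComponent

end PairHamiltonian

/-! ### Bipartite entanglement -/

section Bipartite

variable {m n : Type*} [Fintype m] [DecidableEq m] [Fintype n]

/-- The coefficient matrix of a bipartite vector. -/
def coeffMatrix (ψ : m × n → ℂ) : Matrix m n ℂ := fun i j => ψ (i, j)

/-- The Schmidt measure of a bipartite vector: `log₂` of its Schmidt rank. -/
def schmidtMeasure (ψ : m × n → ℂ) : ℝ := Real.logb 2 (coeffMatrix ψ).rank

/-- The entanglement entropy of a bipartite unit vector, in e-bits: the von Neumann entropy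
`- ∑ λ log₂ λ` of its reduced state on the first factor. -/
def entanglementEntropy (ψ : m × n → ℂ) : ℝ :=
  ∑ i, Real.negMulLog
    ((Matrix.isHermitian_mul_conjTranspose_self (coeffMatrix ψ)).eigenvalues i) / Real.log 2

/-- The entanglement of formation of a bipartite state: the infimum of the average entanglement
entropy over all finite decompositions into pure states. -/
def entanglementOfFormation (ρ : Matrix (m × n) (m × n) ℂ) : ℝ :=
  sInf {s : ℝ | ∃ (k : ℕ) (p : Fin k → ℝ) (ψ : Fin k → m × n → ℂ),
    (∀ i, 0 ≤ p i) ∧ ∑ i, p i = 1 ∧ (∀ i, star (ψ i) ⬝ᵥ ψ i = 1) ∧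
    ρ = ∑ i, (p i : ℂ) • Matrix.vecMulVec (ψ i) (star (ψ i)) ∧
    s = ∑ i, p i * entanglementEntropy (ψ i)}

end Bipartite

/-! ### Subsystems of spins -/

section Subsystems

variable {V : Type*} [Fintype V] [DecidableEq V]

/-- A vector on `V` as a bipartite vector on `A` and its complement. -/
def cut (A : Finset V) (Φ : (V → Fin 2) → ℂ) :
    (A → Fin 2) × ({v : V // v ∉ A} → Fin 2) → ℂ :=
  fun p => Φ fun v => if h : v ∈ A then p.1 ⟨v, h⟩ else p.2 ⟨v, h⟩

/-- The reduction to `A` of a space `M` of state vectors: the span of the supports of all reduced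
states `tr_{V \ A} |Φ⟩⟨Φ|`, `Φ ∈ M`. (The support of such a reduced state is the column space of
the coefficient matrix of `Φ`.) -/
def reducedSpace (A : Finset V) (M : Submodule ℂ ((V → Fin 2) → ℂ)) :
    Submodule ℂ ((A → Fin 2) → ℂ) :=
  ⨆ Φ ∈ M, LinearMap.range (coeffMatrix (cut A Φ)).mulVecLin

/-- The configuration of `V` that is `p.1` on `A`, `p.2` on `C` and `z` on the other spins. -/
def glue (A C : Finset V) (p : (A → Fin 2) × (C → Fin 2))
    (z : {v : V // v ∉ A ∧ v ∉ C} → Fin 2) : V → Fin 2 :=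
  fun v => if hA : v ∈ A then p.1 ⟨v, hA⟩
    else if hC : v ∈ C then p.2 ⟨v, hC⟩ else z ⟨v, hA, hC⟩

/-- The reduced state on `A ∪ C`, for disjoint `A` and `C`, as a bipartite state on `A` and `C`:
all the other spins are traced out. -/
def reducedState (A C : Finset V) (ρ : Matrix (V → Fin 2) (V → Fin 2) ℂ) :
    Matrix ((A → Fin 2) × (C → Fin 2)) ((A → Fin 2) × (C → Fin 2)) ℂ :=
  fun p q => ∑ z, ρ (glue A C p z) (glue A C q z)

/-- A density operator supported on the space `M` (the pure states of `M` and the maximally mixed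
state over `M` are examples). -/
structure IsStateOn (M : Submodule ℂ ((V → Fin 2) → ℂ))
    (ρ : Matrix (V → Fin 2) (V → Fin 2) ℂ) : Prop where
  posSemidef : ρ.PosSemidef
  trace_one : ρ.trace = 1
  support : ∀ φ, ρ.mulVec φ ∈ M

end Subsystems

end

/-! An entangled excited state of a term, read as a functional, is an invertible 2×2 matrix
annihilating every two-spin slice of a kernel vector. Such constraints on ab and bc compose to one
on ac (`contractPair_trans`), so connectedness gives one for every pair of spins
(`PairHamiltonian.isPairConstrained_ker`). If a one-spin functional also annihilates the space, it
propagates to all spins and leaves at most one product vector up to scale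
(`IsPairConstrained.finrank_le_one`). Hence contracting a spin with a non-zero functional loses at
most one dimension, and n spins allow at most n + 1. A heavy term adds a product constraint, because
every pencil of 2×2 matrices contains a singular one; contracting one of its factors then leaves
dimension at most 2. So a single heavy edge already gives the bound 2, and without heavy edges the
components are single spins and n + 1 is the bound (`PairHamiltonian.finrank_ker_op_le`).

Frustration-freeness places the reduced space inside ker H_A, and its dimension bounds the Schmidt
ranks across A. A reduced state on A ∪ C is a mixture of slices of ground vectors, whose coefficient
matrices are made of columns of those across A; entropy at most the log of the rank then bounds the
entanglement of formation. -/

/-! ### Contracting one or two spins with a functional -/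

section Contraction

variable {W : Type*} [DecidableEq W]

/-- Contraction of the spin `b` with the functional `β`. The result is a vector on all of `W` that
does not depend on the spin `b`. -/
def contractSite (b : W) (β : Fin 2 → ℂ) :
    ((W → Fin 2) → ℂ) →ₗ[ℂ] ((W → Fin 2) → ℂ) where
  toFun Φ x := ∑ i, β i * Φ (Function.update x b i)
  map_add' Φ Ψ := by
    ext x
    simp only [Pi.add_apply, mul_add, Finset.sum_add_distrib]
  map_smul' c Φ := by
    ext x
    simp only [Pi.smul_apply, smul_eq_mul, RingHom.id_apply, Finset.mul_sum]
    exact Finset.sum_congr rfl fun i _ => by ring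

/-- Contraction of the spins `a`, `b` with the two-spin functional `M`. -/
def contractPair (a b : W) (M : Matrix (Fin 2) (Fin 2) ℂ) (Φ : (W → Fin 2) → ℂ) :
    (W → Fin 2) → ℂ :=
  fun x => ∑ i, ∑ j, M i j * Φ (Function.update (Function.update x a i) b j)

theorem contractSite_apply (b : W) (β : Fin 2 → ℂ) (Φ : (W → Fin 2) → ℂ) (x : W → Fin 2) :
    contractSite b β Φ x = ∑ i, β i * Φ (Function.update x b i) := rfl

theorem contractPair_contractSite {a b c : W} (ha : b ≠ a) (hc : b ≠ c)
    (M : Matrix (Fin 2) (Fin 2) ℂ) (β : Fin 2 → ℂ) (Φ : (W → Fin 2) → ℂ) :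
    contractPair a c M (contractSite b β Φ) = contractSite b β (contractPair a c M Φ) := by
  ext x
  have h : ∀ i j k, Function.update (Function.update (Function.update x a i) c j) b k =
      Function.update (Function.update (Function.update x b k) a i) c j := by
    intro i j k
    rw [Function.update_comm hc.symm, Function.update_comm ha.symm]
  simp only [contractPair, contractSite_apply, Fin.sum_univ_two, h]
  ring

theorem contractPair_vecMulVec {a b : W} (α β : Fin 2 → ℂ)
    (Φ : (W → Fin 2) → ℂ) :
    contractPair a b (Matrix.vecMulVec α β) Φ = contractSite a α (contractSite b β Φ) := by
  ext x
  simp only [contractPair, contractSite_apply, Fin.sum_univ_two, Matrix.vecMulVec_apply]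
  ring

theorem dependsOn_contractSite {S : Finset W} {Φ : (W → Fin 2) → ℂ} (hΦ : DependsOn Φ (S : Set W))
    (b : W) (β : Fin 2 → ℂ) : DependsOn (contractSite b β Φ) (S.erase b : Set W) := by
  intro x y hxy
  simp only [contractSite_apply]
  refine Finset.sum_congr rfl fun i _ => ?_
  congr 1
  refine hΦ fun v hv => ?_
  by_cases hvb : v = b
  · subst hvb; simp
  · simp only [Function.update_of_ne hvb]
    exact hxy v (by simp [hvb]; exact hv)

/-- Two invertible two-spin constraints that share a spin imply an invertible constraint on the
two other spins. -/
theorem contractPair_trans {a b c : W} (hab : a ≠ b) (hbc : b ≠ c) (hac : a ≠ c)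
    {M N : Matrix (Fin 2) (Fin 2) ℂ} {Φ : (W → Fin 2) → ℂ}
    (hM : contractPair a b M Φ = 0) (hN : contractPair b c N Φ = 0) :
    contractPair a c (M * !![0, 1; -1, 0] * N) Φ = 0 := by
  ext x
  have hM' : ∀ k, ∑ i, ∑ j, M i j * Φ (Function.update (Function.update (Function.update x a i)
      b j) c k) = 0 := by
    intro k
    have h := congrFun hM (Function.update x c k)
    simpa only [contractPair, Pi.zero_apply, Function.update_comm hac.symm,
      Function.update_comm hbc.symm] using h
  have hN' : ∀ i, ∑ j, ∑ k, N j k * Φ (Function.update (Function.update (Function.update x a i)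
      b j) c k) = 0 := fun i => congrFun hN (Function.update x a i)
  -- The spin b is not summed over in the goal; writing its value as an explicit update allows a
  -- case split on it.
  have hx : ∀ i k, Function.update (Function.update x a i) c k =
      Function.update (Function.update (Function.update x a i) b (x b)) c k := by
    intro i k
    congr 1
    rw [eq_comm, Function.update_eq_self_iff, Function.update_of_ne hab.symm]
  simp only [contractPair, hx, Pi.zero_apply, Fin.sum_univ_two] at hM' hN' ⊢
  have hM0 := hM' 0
  have hM1 := hM' 1
  have hN0 := hN' 0
  have hN1 := hN' 1
  simp only [Matrix.mul_apply, Fin.sum_univ_two, Matrix.of_apply, Matrix.cons_val_zero,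
    Matrix.cons_val_one, Matrix.cons_val', Matrix.cons_val_fin_one]
  -- Weighting the M-relations by a row of N and the N-relations by a column of M cancels the
  -- amplitudes with the other value of b.
  rcases Fin.exists_fin_two.mp ⟨x b, rfl⟩ with h | h
  · rw [h]
    linear_combination N 1 0 * hM0 + N 1 1 * hM1 - M 0 1 * hN0 - M 1 1 * hN1
  · rw [h]
    linear_combination -N 0 0 * hM0 - N 0 1 * hM1 + M 0 0 * hN0 + M 1 0 * hN1

/-- If a one-spin functional annihilates `Φ` on the spin `a`, and `a`, `b` satisfy an invertible
constraint, then a one-spin functional annihilates `Φ` on the spin `b`. -/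
theorem contractSite_propagate {a b : W} (hab : a ≠ b) {M : Matrix (Fin 2) (Fin 2) ℂ}
    {α : Fin 2 → ℂ} {Φ : (W → Fin 2) → ℂ}
    (hΦ : contractSite a α Φ = 0) (hM : contractPair a b M Φ = 0) :
    contractSite b (Matrix.vecMul ![-α 1, α 0] M) Φ = 0 := by
  -- On spin a, α leaves only multiples of (-α 1, α 0); inserting this vector into M gives the
  -- functional on b.
  ext x
  have h1 : ∀ j, α 0 * Φ (Function.update (Function.update x a 0) b j) +
      α 1 * Φ (Function.update (Function.update x a 1) b j) = 0 := by
    intro j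
    have h := congrFun hΦ (Function.update x b j)
    simpa only [contractSite_apply, Pi.zero_apply, Function.update_comm hab.symm,
      Fin.sum_univ_two] using h
  have h2 := congrFun hM x
  have hx : ∀ j, Function.update x b j = Function.update (Function.update x a (x a)) b j := by
    intro j; simp
  simp only [contractPair, contractSite_apply, Pi.zero_apply, Fin.sum_univ_two, Matrix.vecMul,
    dotProduct, Matrix.cons_val_zero, Matrix.cons_val_one] at h2 ⊢
  rw [hx 0, hx 1]
  have h10 := h1 0
  have h11 := h1 1
  rcases Fin.exists_fin_two.mp ⟨x a, rfl⟩ with h | h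
  · rw [h]
    linear_combination (-α 1) * h2 + M 1 0 * h10 + M 1 1 * h11
  · rw [h]
    linear_combination α 0 * h2 - M 0 0 * h10 - M 0 1 * h11

end Contraction

/-! ### Spaces of vectors constrained on every pair of spins -/

section Constrained

variable {W : Type*} [DecidableEq W]

/-- Each pair of spins of `S` carries an invertible (entangled) two-spin functional that
annihilates the whole space `K`. -/
def IsPairConstrained (S : Finset W) (K : Submodule ℂ ((W → Fin 2) → ℂ)) : Prop :=
  ∀ a ∈ S, ∀ b ∈ S, a ≠ b →
    ∃ M : Matrix (Fin 2) (Fin 2) ℂ, M.det ≠ 0 ∧ ∀ Φ ∈ K, contractPair a b M Φ = 0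

theorem IsPairConstrained.mono {S : Finset W} {K K' : Submodule ℂ ((W → Fin 2) → ℂ)}
    (h : IsPairConstrained S K) (hK : K' ≤ K) : IsPairConstrained S K' :=
  fun a ha b hb hab => (h a ha b hb hab).imp fun _ hM => ⟨hM.1, fun Φ hΦ => hM.2 Φ (hK hΦ)⟩

theorem IsPairConstrained.map_contractSite {S : Finset W} {K : Submodule ℂ ((W → Fin 2) → ℂ)}
    (h : IsPairConstrained S K) (b : W) (β : Fin 2 → ℂ) :
    IsPairConstrained (S.erase b) (K.map (contractSite b β)) := by
  intro a ha c hc hac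
  rw [Finset.mem_erase] at ha hc
  obtain ⟨M, hdet, hM⟩ := h a ha.2 c hc.2 hac
  refine ⟨M, hdet, ?_⟩
  rintro _ ⟨Φ, hΦ, rfl⟩
  rw [contractPair_contractSite ha.1.symm hc.1.symm, hM Φ hΦ, map_zero]

/-- A space of vectors annihilated by a one-spin functional on each spin they depend on is at most
one-dimensional: it consists of the multiples of one product vector. -/
theorem finrank_le_one_of_contractSite {S : Finset W} {K : Submodule ℂ ((W → Fin 2) → ℂ)}
    (hdep : ∀ Φ ∈ K, DependsOn Φ (S : Set W))
    (hK : ∀ v ∈ S, ∃ α : Fin 2 → ℂ, α ≠ 0 ∧ ∀ Φ ∈ K, contractSite v α Φ = 0) :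
    Module.finrank ℂ K ≤ 1 := by
  -- The relation α 0 Φ₀ + α 1 Φ₁ = 0 lets one amplitude determine the other; s is the value of v
  -- whose amplitude decides. Outside S the value is arbitrary.
  have hsel : ∀ v, ∃ s : Fin 2, v ∈ S →
      ∀ Φ ∈ K, ∀ x, Φ (Function.update x v s) = 0 → Φ x = 0 := by
    intro v
    by_cases hv : v ∈ S
    swap
    · exact ⟨0, fun h => absurd h hv⟩
    obtain ⟨α, hα, hαK⟩ := hK v hv
    have key : ∀ Φ ∈ K, ∀ x,
        α 0 * Φ (Function.update x v 0) + α 1 * Φ (Function.update x v 1) = 0 :=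
      fun Φ hΦ x => by
        have h := congrFun (hαK Φ hΦ) x
        simpa only [contractSite_apply, Pi.zero_apply, Fin.sum_univ_two] using h
    have hself : ∀ (Φ : (W → Fin 2) → ℂ) x, Φ x = Φ (Function.update x v (x v)) :=
      fun Φ x => by simp
    by_cases h0 : α 0 = 0
    · have h1 : α 1 ≠ 0 := fun h1 => hα (by ext i; fin_cases i <;> simp [h0, h1])
      refine ⟨0, fun _ Φ hΦ x hx => ?_⟩
      have hk := key Φ hΦ x
      rw [hx, mul_zero, zero_add, mul_eq_zero, or_iff_right h1] at hk
      rw [hself Φ x]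
      rcases Fin.exists_fin_two.mp ⟨x v, rfl⟩ with h | h <;> rw [h] <;> assumption
    · refine ⟨1, fun _ Φ hΦ x hx => ?_⟩
      have hk := key Φ hΦ x
      rw [hx, mul_zero, add_zero, mul_eq_zero, or_iff_right h0] at hk
      rw [hself Φ x]
      rcases Fin.exists_fin_two.mp ⟨x v, rfl⟩ with h | h <;> rw [h] <;> assumption
  choose s hs using hsel
  have hzero : ∀ Φ ∈ K, Φ s = 0 → Φ = 0 := by
    intro Φ hΦ h0
    -- Induction on the set T of spins of S where x may differ from the reference configuration s.
    have hind : ∀ T : Finset W, T ⊆ S → ∀ x, (∀ v ∈ S, v ∉ T → x v = s v) → Φ x = 0 := by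
      intro T
      induction T using Finset.induction_on with
      | empty =>
        intro _ x hx
        rw [← h0]
        exact hdep Φ hΦ fun v hv => hx v hv (Finset.notMem_empty v)
      | insert v T hv ih =>
        intro hT x hx
        refine hs v (hT (Finset.mem_insert_self v T)) Φ hΦ x ?_
        refine ih (fun w hw => hT (Finset.mem_insert_of_mem hw)) _ fun w hw hwT => ?_
        by_cases hwv : w = v
        · subst hwv; simp
        · rw [Function.update_of_ne hwv]
          exact hx w hw (by simp [hwv, hwT])
    ext x
    exact hind S subset_rfl x fun v hv hv' => absurd hv hv'
  let f : K →ₗ[ℂ] ℂ := (LinearMap.proj s).comp K.subtype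
  have hf : Function.Injective f := by
    rw [← LinearMap.ker_eq_bot, LinearMap.ker_eq_bot']
    intro Φ hΦ
    exact Subtype.ext (hzero Φ Φ.2 hΦ)
  simpa using LinearMap.finrank_le_finrank_of_injective hf

/-- If moreover a one-spin functional on a spin of `S` annihilates the space, the space is at most
one-dimensional. -/
theorem IsPairConstrained.finrank_le_one {S : Finset W} {K : Submodule ℂ ((W → Fin 2) → ℂ)}
    (h : IsPairConstrained S K) (hdep : ∀ Φ ∈ K, DependsOn Φ (S : Set W))
    {a : W} (ha : a ∈ S) {α : Fin 2 → ℂ} (hα : α ≠ 0) (hK : ∀ Φ ∈ K, contractSite a α Φ = 0) :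
    Module.finrank ℂ K ≤ 1 := by
  refine finrank_le_one_of_contractSite hdep fun v hv => ?_
  by_cases hav : a = v
  · subst hav
    exact ⟨α, hα, hK⟩
  obtain ⟨M, hdet, hM⟩ := h a ha v hv hav
  refine ⟨_, fun h0 => hα ?_, fun Φ hΦ => contractSite_propagate hav (hK Φ hΦ) (hM Φ hΦ)⟩
  -- Invertibility of M keeps the propagated functional non-zero.
  have h1 := Matrix.eq_zero_of_vecMul_eq_zero hdet h0
  have h10 := congrFun h1 0
  have h11 := congrFun h1 1
  simp only [Matrix.cons_val_zero, Matrix.cons_val_one, Pi.zero_apply, neg_eq_zero] at h10 h11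
  ext i
  fin_cases i <;> simp [h10, h11]

variable [Fintype W]

/-- Rank–nullity for f restricted to K. -/
theorem Submodule.finrank_le_finrank_inf_ker_add_finrank_map {E : Type*} [AddCommGroup E]
    [Module ℂ E] [FiniteDimensional ℂ E] (K : Submodule ℂ E) (f : E →ₗ[ℂ] E) :
    Module.finrank ℂ K ≤
      Module.finrank ℂ (K ⊓ LinearMap.ker f : Submodule ℂ E) + Module.finrank ℂ (K.map f) := by
  have h := LinearMap.finrank_range_add_finrank_ker (f.domRestrict K)
  rw [LinearMap.range_domRestrict] at h
  have h2 : Module.finrank ℂ (LinearMap.ker (f.domRestrict K)) =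
      Module.finrank ℂ (K ⊓ LinearMap.ker f : Submodule ℂ E) := by
    have : (LinearMap.ker (f.domRestrict K)).map K.subtype = K ⊓ LinearMap.ker f := by
      ext x
      simp [and_comm]
    rw [← this]
    exact (LinearEquiv.finrank_eq (Submodule.equivMapOfInjective _ K.injective_subtype _))
  omega

/-- Contracting a spin of a pairwise constrained space loses at most one dimension. -/
theorem IsPairConstrained.finrank_le_finrank_map_add_one {S : Finset W}
    {K : Submodule ℂ ((W → Fin 2) → ℂ)} (h : IsPairConstrained S K)
    (hdep : ∀ Φ ∈ K, DependsOn Φ (S : Set W)) {b : W} (hb : b ∈ S) {β : Fin 2 → ℂ} (hβ : β ≠ 0) :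
    Module.finrank ℂ K ≤ Module.finrank ℂ (K.map (contractSite b β)) + 1 := by
  have h1 := K.finrank_le_finrank_inf_ker_add_finrank_map (contractSite b β)
  -- The vectors lost are those that β annihilates on b: a pairwise constrained space with a
  -- one-spin functional.
  have h2 := (h.mono (K' := K ⊓ LinearMap.ker (contractSite b β)) inf_le_left).finrank_le_one
    (fun Φ hΦ => hdep Φ hΦ.1) hb hβ (fun Φ hΦ => hΦ.2)
  omega

/-- A pairwise constrained space on `n` spins has dimension at most `n + 1`. -/
theorem IsPairConstrained.finrank_le_card_add_one {S : Finset W} :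
    ∀ {K : Submodule ℂ ((W → Fin 2) → ℂ)}, IsPairConstrained S K →
      (∀ Φ ∈ K, DependsOn Φ (S : Set W)) → Module.finrank ℂ K ≤ S.card + 1 := by
  induction S using Finset.induction_on with
  | empty =>
    intro K _ hdep
    simpa using finrank_le_one_of_contractSite hdep (by simp)
  | insert b S hb ih =>
    intro K h hdep
    -- Any non-zero functional would do; here it is (1, 1).
    have hmap := h.map_contractSite b 1
    have herase : (insert b S).erase b = S := Finset.erase_insert hb
    rw [herase] at hmap
    have h1 := ih hmap (by
      rintro _ ⟨Φ, hΦ, rfl⟩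
      simpa only [herase] using dependsOn_contractSite (hdep Φ hΦ) b 1)
    have h2 := h.finrank_le_finrank_map_add_one hdep (Finset.mem_insert_self b S)
      (β := 1) one_ne_zero
    rw [Finset.card_insert_of_notMem hb]
    omega

/-- A pairwise constrained space that also satisfies a product constraint on some pair of spins has
dimension at most two. -/
theorem IsPairConstrained.finrank_le_two {S : Finset W} {K : Submodule ℂ ((W → Fin 2) → ℂ)}
    (h : IsPairConstrained S K) (hdep : ∀ Φ ∈ K, DependsOn Φ (S : Set W))
    {a b : W} (ha : a ∈ S) (hb : b ∈ S) (hab : a ≠ b) {α β : Fin 2 → ℂ} (hα : α ≠ 0) (hβ : β ≠ 0)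
    (hK : ∀ Φ ∈ K, contractPair a b (Matrix.vecMulVec α β) Φ = 0) :
    Module.finrank ℂ K ≤ 2 := by
  have h1 := h.finrank_le_finrank_map_add_one hdep hb hβ
  -- After contraction with β, the product constraint becomes the one-spin functional α on a.
  have h2 : Module.finrank ℂ (K.map (contractSite b β)) ≤ 1 := by
    refine (h.map_contractSite b β).finrank_le_one ?_ (Finset.mem_erase.mpr ⟨hab, ha⟩) hα ?_
    · rintro _ ⟨Φ, hΦ, rfl⟩
      exact dependsOn_contractSite (hdep Φ hΦ) b β
    · rintro _ ⟨Φ, hΦ, rfl⟩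
      rw [← contractPair_vecMulVec, hK Φ hΦ]
  omega

end Constrained

/-! ### Two-spin functionals -/

section TwoSpin

/-- A two-spin functional of determinant zero is a product. -/
theorem exists_eq_vecMulVec_of_det_eq_zero {M : Matrix (Fin 2) (Fin 2) ℂ} (hM : M.det = 0) :
    ∃ α β : Fin 2 → ℂ, M = Matrix.vecMulVec α β := by
  rw [Matrix.det_fin_two] at hM
  by_cases h0 : M 0 = 0
  · refine ⟨![0, 1], M 1, ?_⟩
    ext i j
    fin_cases i
    · simp [Matrix.vecMulVec_apply, h0]
    · simp [Matrix.vecMulVec_apply]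
  · obtain ⟨j, hj⟩ : ∃ j, M 0 j ≠ 0 := by
      by_contra! h
      exact h0 (funext h)
    -- The second row is a multiple of the non-zero first row; the ratio is read off in column j.
    refine ⟨![1, M 1 j / M 0 j], M 0, ?_⟩
    ext i k
    fin_cases i
    · simp [Matrix.vecMulVec_apply]
    · simp only [Matrix.vecMulVec_apply, Fin.mk_one, Matrix.cons_val_one, Matrix.cons_val_fin_one]
      rw [div_mul_eq_mul_div, eq_div_iff hj]
      fin_cases j <;> fin_cases k <;> simp only [Fin.mk_one, Fin.zero_eta]
      · linear_combination hM
      · linear_combination -hM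

/-- The conjugate appears because pairing with ψ is the functional with coefficients conj ψ. -/
theorem IsEntangled.det_ne_zero {ψ : Fin 2 × Fin 2 → ℂ} (hψ : IsEntangled ψ) :
    (Matrix.of fun i j => star (ψ (i, j))).det ≠ 0 := by
  intro h
  obtain ⟨α, β, hαβ⟩ := exists_eq_vecMulVec_of_det_eq_zero h
  refine hψ ⟨star α, star β, fun i j => ?_⟩
  have h1 := congrFun (congrFun hαβ i) j
  rw [Matrix.of_apply, Matrix.vecMulVec_apply] at h1
  rw [← star_star (ψ (i, j)), h1, star_mul']
  rfl

/-- A pencil spanned by two linearly independent two-spin functionals contains a non-zero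
product functional. -/
theorem exists_product_in_pencil {M N : Matrix (Fin 2) (Fin 2) ℂ}
    (h : LinearIndependent ℂ ![M, N]) :
    ∃ (s t : ℂ) (α β : Fin 2 → ℂ), α ≠ 0 ∧ β ≠ 0 ∧ s • M + t • N = Matrix.vecMulVec α β := by
  obtain ⟨s, t, hst, hdet⟩ : ∃ s t : ℂ, (s ≠ 0 ∨ t ≠ 0) ∧ (s • M + t • N).det = 0 := by
    by_cases hM : M.det = 0
    · exact ⟨1, 0, Or.inl one_ne_zero, by simpa using hM⟩
    -- The determinant of sM + N is a quadratic in s with leading coefficient det M, so it has a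
    -- complex root.
    · obtain ⟨s, hs⟩ := IsAlgClosed.exists_eq_mul_self (discrim M.det
        (M 0 0 * N 1 1 + N 0 0 * M 1 1 - M 0 1 * N 1 0 - N 0 1 * M 1 0) N.det)
      obtain ⟨s, hs⟩ := exists_quadratic_eq_zero hM ⟨s, hs⟩
      refine ⟨s, 1, Or.inr one_ne_zero, ?_⟩
      rw [← hs]
      simp only [Matrix.det_fin_two, Matrix.add_apply, Matrix.smul_apply, smul_eq_mul]
      ring
  obtain ⟨α, β, hαβ⟩ := exists_eq_vecMulVec_of_det_eq_zero hdet
  have hne : s • M + t • N ≠ 0 := by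
    intro h0
    obtain ⟨h1, h2⟩ := LinearIndependent.pair_iff.mp h s t h0
    exact hst.elim (fun h => h h1) (fun h => h h2)
  refine ⟨s, t, α, β, ?_, ?_, hαβ⟩
  · rintro rfl
    exact hne (by rw [hαβ, Matrix.zero_vecMulVec])
  · rintro rfl
    exact hne (by rw [hαβ, Matrix.vecMulVec_zero])

/-- If a matrix on two spins has rank at least two, some non-zero product functional vanishes on
its kernel. -/
theorem exists_product_annihilator {T : Matrix (Fin 2 × Fin 2) (Fin 2 × Fin 2) ℂ}
    (hT : 2 ≤ T.rank) :
    ∃ α β : Fin 2 → ℂ, α ≠ 0 ∧ β ≠ 0 ∧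
      ∀ φ : Fin 2 × Fin 2 → ℂ, T.mulVec φ = 0 → ∑ i, ∑ j, α i * β j * φ (i, j) = 0 := by
  -- The row space of T consists of functionals vanishing on ker T; rank two supplies a pencil of
  -- them.
  rw [← Matrix.rank_transpose, Matrix.rank] at hT
  obtain ⟨f, hf⟩ := exists_linearIndependent_of_le_finrank hT
  have hli : LinearIndependent ℂ fun i => (f i : Fin 2 × Fin 2 → ℂ) :=
    hf.map' _ (Submodule.ker_subtype _)
  have hzero : ∀ k, ∀ φ : Fin 2 × Fin 2 → ℂ, T.mulVec φ = 0 → (f k : Fin 2 × Fin 2 → ℂ) ⬝ᵥ φ = 0 := by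
    intro k φ hφ
    obtain ⟨u, hu⟩ := (f k).2
    rw [← hu, Matrix.mulVecLin_apply, Matrix.mulVec_transpose, ← Matrix.dotProduct_mulVec, hφ,
      dotProduct_zero]
  have hli' : LinearIndependent ℂ
      ![Matrix.of fun i j => (f 0 : Fin 2 × Fin 2 → ℂ) (i, j),
        Matrix.of fun i j => (f 1 : Fin 2 × Fin 2 → ℂ) (i, j)] := by
    rw [LinearIndependent.pair_iff]
    intro s t hst
    have hli2 : LinearIndependent ℂ ![(f 0 : Fin 2 × Fin 2 → ℂ), (f 1 : Fin 2 × Fin 2 → ℂ)] := by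
      convert hli using 1
      ext i
      fin_cases i <;> rfl
    refine LinearIndependent.pair_iff.mp hli2 s t ?_
    ext ⟨i, j⟩
    exact congrFun (congrFun hst i) j
  obtain ⟨s, t, α, β, hα, hβ, hαβ⟩ := exists_product_in_pencil hli'
  refine ⟨α, β, hα, hβ, fun φ hφ => ?_⟩
  have h0 := hzero 0 φ hφ
  have h1 := hzero 1 φ hφ
  have hent : ∀ i j, α i * β j = s * (f 0 : Fin 2 × Fin 2 → ℂ) (i, j) +
      t * (f 1 : Fin 2 × Fin 2 → ℂ) (i, j) :=
    fun i j => (congrFun (congrFun hαβ i) j).symm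
  simp only [dotProduct, Fintype.sum_prod_type] at h0 h1
  simp only [hent, add_mul, mul_assoc, Finset.sum_add_distrib, ← Finset.mul_sum, h0, h1]
  simp

end TwoSpin

/-! ### Two-spin operators embedded in a spin system -/

section Embed

variable {W : Type*} [Fintype W] [DecidableEq W]

theorem embedPair_mulVec_apply {a b : W} (hab : a ≠ b)
    (T : Matrix (Fin 2 × Fin 2) (Fin 2 × Fin 2) ℂ) (Φ : (W → Fin 2) → ℂ) (x : W → Fin 2) :
    (embedPair a b T).mulVec Φ x =
      T.mulVec (fun p => Φ (Function.update (Function.update x a p.1) b p.2)) (x a, x b) := by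
  simp only [Matrix.mulVec, dotProduct]
  symm
  refine Finset.sum_of_injOn (fun p => Function.update (Function.update x a p.1) b p.2)
    ?_ (fun _ _ => Finset.mem_coe.mpr (Finset.mem_univ _)) ?_ ?_
  · intro p _ q _ hpq
    have h1 := congrFun hpq a
    have h2 := congrFun hpq b
    simp only [Function.update_of_ne hab, Function.update_self] at h1 h2
    exact Prod.ext h1 h2
  · intro y _ hy
    rw [embedPair, if_neg, zero_mul]
    intro hxy
    refine hy ⟨(y a, y b), Finset.mem_coe.mpr (Finset.mem_univ _), ?_⟩
    ext c
    by_cases hcb : c = b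
    · subst hcb; simp
    · by_cases hca : c = a
      · subst hca; simp [hcb]
      · simp [hcb, hca, hxy c hca hcb]
  · intro p _
    rw [embedPair, if_pos]
    · simp [Function.update_of_ne hab]
    · intro c hca hcb
      simp [hca, hcb]

/-- `Φ` is annihilated by a two-spin operator on `a`, `b` iff all its slices along `a`, `b` are in
the kernel. -/
theorem embedPair_mulVec_eq_zero_iff {a b : W} (hab : a ≠ b)
    (T : Matrix (Fin 2 × Fin 2) (Fin 2 × Fin 2) ℂ) (Φ : (W → Fin 2) → ℂ) :
    (embedPair a b T).mulVec Φ = 0 ↔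
      ∀ x, T.mulVec (fun p => Φ (Function.update (Function.update x a p.1) b p.2)) = 0 := by
  constructor
  · intro h x
    ext ⟨i, j⟩
    -- Overwriting the values at a and b leaves the slice unchanged, so these evaluations read off
    -- all its components.
    have h1 := congrFun h (Function.update (Function.update x a i) b j)
    rw [embedPair_mulVec_apply hab] at h1
    have h2 : ∀ i' j', Function.update (Function.update (Function.update (Function.update x a i)
        b j) a i') b j' = Function.update (Function.update x a i') b j' := by
      intro i' j'
      ext c
      by_cases hcb : c = b
      · subst hcb; simp
      · by_cases hca : c = a
        · subst hca; simp [hcb]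
        · simp [hcb, hca]
    simp only [h2, Function.update_self, Function.update_of_ne hab] at h1
    exact h1
  · intro h
    ext x
    rw [embedPair_mulVec_apply hab, h x]
    rfl

/-- Regrouping the spins exhibits the operator as a submatrix of T ⊗ 1; this also covers a = b. -/
theorem embedPair_posSemidef (a b : W) {T : Matrix (Fin 2 × Fin 2) (Fin 2 × Fin 2) ℂ}
    (hT : T.PosSemidef) : (embedPair a b T).PosSemidef := by
  have h := (hT.kronecker (Matrix.PosSemidef.one (n := {c : W // c ≠ a ∧ c ≠ b} → Fin 2)
    (R := ℂ))).submatrix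
    (fun x : W → Fin 2 => ((x a, x b), fun c : {c : W // c ≠ a ∧ c ≠ b} => x c))
  suffices heq : embedPair a b T = (Matrix.kroneckerMap (fun x y => x * y) T 1).submatrix
      (fun x : W → Fin 2 => ((x a, x b), fun c : {c : W // c ≠ a ∧ c ≠ b} => x c))
      (fun x : W → Fin 2 => ((x a, x b), fun c : {c : W // c ≠ a ∧ c ≠ b} => x c)) by
    rw [heq]
    exact h
  ext x y
  simp only [embedPair, Matrix.submatrix_apply, Matrix.kroneckerMap_apply, Matrix.one_apply,
    mul_ite, mul_one, mul_zero]
  congr 1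
  rw [funext_iff, Subtype.forall]
  exact propext ⟨fun h c hc => h c hc.1 hc.2, fun h c h1 h2 => h c ⟨h1, h2⟩⟩

end Embed

/-! ### The dimension of the kernel -/

namespace PairHamiltonian

variable {W : Type*} [Fintype W] [DecidableEq W]

theorem embedPair_term_self (H : PairHamiltonian W) (a : W) :
    embedPair a a (H.term a a) = 0 := by
  rw [H.term_self]
  ext x y
  simp [embedPair]

/-- For terms `≥ 0`, the kernel of `H` is the common kernel of the terms. -/
theorem op_mulVec_eq_zero_iff (H : PairHamiltonian W) (hpos : ∀ a b, (H.term a b).PosSemidef)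
    (Φ : (W → Fin 2) → ℂ) :
    H.op.mulVec Φ = 0 ↔ ∀ a b, (embedPair a b (H.term a b)).mulVec Φ = 0 := by
  set F : Sym2 W → Matrix (W → Fin 2) (W → Fin 2) ℂ :=
    Sym2.lift ⟨fun a b => embedPair a b (H.term a b), H.embedPair_term_comm⟩ with hF
  have hop : H.op.mulVec Φ = ∑ e, (F e).mulVec Φ := by
    rw [op, Matrix.sum_mulVec]
  have hFpos : ∀ e, (F e).PosSemidef := by
    intro e
    induction e with
    | _ a b => exact embedPair_posSemidef a b (hpos a b)
  rw [hop]
  constructor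
  · intro h a b
    -- Non-negative expectation values summing to zero all vanish.
    have h1 : ∑ e, star Φ ⬝ᵥ (F e).mulVec Φ = 0 := by
      rw [← dotProduct_sum, h, dotProduct_zero]
    rw [Finset.sum_eq_zero_iff_of_nonneg
      fun e _ => (hFpos e).dotProduct_mulVec_nonneg Φ] at h1
    exact ((hFpos s(a, b)).dotProduct_mulVec_zero_iff Φ).mp (h1 s(a, b) (Finset.mem_univ _))
  · intro h
    refine Finset.sum_eq_zero fun e _ => ?_
    induction e with
    | _ a b => exact h a b

/-- If the interaction graph is connected and each term has an entangled excited state, the kernel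
of the Hamiltonian satisfies an entangled constraint on each pair of spins. -/
theorem isPairConstrained_ker (H : PairHamiltonian W) (hpos : ∀ a b, (H.term a b).PosSemidef)
    (hconn : H.interactionGraph.Preconnected)
    (hent : ∀ a b, H.term a b ≠ 0 → ∃ ψ : Fin 2 × Fin 2 → ℂ, IsEntangled ψ ∧
      ∀ φ, (H.term a b).mulVec φ = 0 → star φ ⬝ᵥ ψ = 0) :
    IsPairConstrained Finset.univ (LinearMap.ker H.op.mulVecLin) := by
  have hadj : ∀ a b, H.interactionGraph.Adj a b → ∃ M : Matrix (Fin 2) (Fin 2) ℂ, M.det ≠ 0 ∧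
      ∀ Φ ∈ LinearMap.ker H.op.mulVecLin, contractPair a b M Φ = 0 := by
    intro a b hab
    obtain ⟨ψ, hψ, hker⟩ := hent a b hab
    refine ⟨_, hψ.det_ne_zero, fun Φ hΦ => ?_⟩
    rw [LinearMap.mem_ker, Matrix.mulVecLin_apply, H.op_mulVec_eq_zero_iff hpos] at hΦ
    ext x
    have h1 := hker _ ((embedPair_mulVec_eq_zero_iff hab.ne _ Φ).mp (hΦ a b) x)
    -- Conjugation turns orthogonality to ψ into a linear functional of the slice.
    have h2 := congrArg star h1
    rw [Matrix.star_dotProduct, star_zero, star_star] at h2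
    rw [dotProduct, Fintype.sum_prod_type] at h2
    exact h2
  have hreach : ∀ a b, H.interactionGraph.Reachable a b → a ≠ b →
      ∃ M : Matrix (Fin 2) (Fin 2) ℂ, M.det ≠ 0 ∧
        ∀ Φ ∈ LinearMap.ker H.op.mulVecLin, contractPair a b M Φ = 0 := by
    rintro a b ⟨p⟩
    induction p with
    | nil => exact fun h => absurd rfl h
    | @cons a b c hab p ih =>
      intro hac
      obtain ⟨M, hMdet, hM⟩ := hadj a b hab
      -- If the remaining walk is closed, the first edge alone gives the constraint.
      by_cases hbc : b = c
      · subst hbc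
        exact ⟨M, hMdet, hM⟩
      · obtain ⟨N, hNdet, hN⟩ := ih hbc
        refine ⟨M * !![0, 1; -1, 0] * N, ?_, fun Φ hΦ =>
          contractPair_trans hab.ne hbc hac (hM Φ hΦ) (hN Φ hΦ)⟩
        simp [Matrix.det_mul, hMdet, hNdet]
  exact fun a _ b _ hab => hreach a b (hconn a b) hab

/-- The kernel of a connected Hamiltonian whose terms have entangled excited states has dimension
at most the number of heavy components plus one. -/
theorem finrank_ker_op_le (H : PairHamiltonian W) (hpos : ∀ a b, (H.term a b).PosSemidef)
    (hconn : H.interactionGraph.Preconnected)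
    (hent : ∀ a b, H.term a b ≠ 0 → ∃ ψ : Fin 2 × Fin 2 → ℂ, IsEntangled ψ ∧
      ∀ φ, (H.term a b).mulVec φ = 0 → star φ ⬝ᵥ ψ = 0) :
    Module.finrank ℂ (LinearMap.ker H.op.mulVecLin) ≤
      Nat.card H.heavyGraph.ConnectedComponent + 1 := by
  have hc := H.isPairConstrained_ker hpos hconn hent
  have hdep : ∀ Φ ∈ LinearMap.ker H.op.mulVecLin, DependsOn Φ ((Finset.univ : Finset W) : Set W) :=
    fun Φ _ x y hxy => congrArg Φ (funext fun v => hxy v (by simp))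
  by_cases hheavy : ∃ a b, H.heavyGraph.Adj a b
  · obtain ⟨a, b, hab⟩ := hheavy
    have hrank : 2 ≤ (H.term a b).rank := by
      rcases hab with h | h <;> omega
    obtain ⟨α, β, hα, hβ, hαβ⟩ := exists_product_annihilator hrank
    have h2 := hc.finrank_le_two hdep (Finset.mem_univ a) (Finset.mem_univ b) hab.ne hα hβ (by
      intro Φ hΦ
      rw [LinearMap.mem_ker, Matrix.mulVecLin_apply, H.op_mulVec_eq_zero_iff hpos] at hΦ
      ext x
      exact hαβ _ ((embedPair_mulVec_eq_zero_iff hab.ne _ Φ).mp (hΦ a b) x))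
    -- At least one component exists, so 2 is within the claimed bound.
    have : Nonempty H.heavyGraph.ConnectedComponent := ⟨H.heavyGraph.connectedComponentMk a⟩
    have h1 : 0 < Nat.card H.heavyGraph.ConnectedComponent := Nat.card_pos
    omega
  · have hbot : H.heavyGraph = ⊥ := by
      ext a b
      simpa using fun h => hheavy ⟨a, b, h⟩
    have hcard : Nat.card W ≤ Nat.card H.heavyGraph.ConnectedComponent := by
      refine Nat.card_le_card_of_injective H.heavyGraph.connectedComponentMk fun a b hab => ?_
      rw [SimpleGraph.ConnectedComponent.eq, hbot, SimpleGraph.reachable_bot] at hab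
      exact hab
    have h1 := hc.finrank_le_card_add_one hdep
    rw [Finset.card_univ, ← Nat.card_eq_fintype_card] at h1
    omega

end PairHamiltonian

/-! ### Entanglement entropy and entanglement of formation -/

section Entropy

/-- A probability vector with at most `r` non-zero entries has entropy at most `log r`. -/
theorem sum_negMulLog_le_log_card {ι : Type*} [Fintype ι] (p : ι → ℝ) (hp : ∀ i, 0 ≤ p i)
    (hsum : ∑ i, p i = 1) :
    ∑ i, Real.negMulLog (p i) ≤ Real.log (Fintype.card {i // p i ≠ 0}) := by
  classical
  set s : Finset ι := Finset.univ.filter fun i => p i ≠ 0 with hs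
  have hcard : Fintype.card {i // p i ≠ 0} = s.card := Fintype.card_subtype _
  have hsum' : ∑ i ∈ s, p i = 1 := by
    rw [← hsum]
    exact Finset.sum_filter_ne_zero _
  have hS : ∑ i, Real.negMulLog (p i) = ∑ i ∈ s, Real.negMulLog (p i) := by
    symm
    refine Finset.sum_subset (Finset.subset_univ _) fun i _ hi => ?_
    have : p i = 0 := by simpa [hs] using hi
    simp [this]
  have hne : s.Nonempty := by
    rw [Finset.nonempty_iff_ne_empty]
    intro h
    simp [h] at hsum'
  have hr : (0 : ℝ) < s.card := by exact_mod_cast hne.card_pos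
  -- Jensen with uniform weights on the support only, so that the count is of non-zero entries.
  have hJ := Real.concaveOn_negMulLog.le_map_sum (t := s) (w := fun _ => (s.card : ℝ)⁻¹) (p := p)
    (fun _ _ => by positivity) (by simp [hr.ne']) (fun i _ => hp i)
  simp only [smul_eq_mul, ← Finset.mul_sum, hsum', mul_one, Real.negMulLog, Real.log_inv] at hJ
  rw [hcard, hS]
  have h2 := mul_le_mul_of_nonneg_left hJ hr.le
  simp only [Real.negMulLog]
  rw [← mul_assoc, mul_inv_cancel₀ hr.ne', one_mul] at h2
  refine h2.trans (le_of_eq ?_)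
  field_simp

variable {m n : Type*} [Fintype m] [Fintype n]

theorem trace_coeffMatrix_mul_conjTranspose (ψ : m × n → ℂ) :
    (coeffMatrix ψ * (coeffMatrix ψ).conjTranspose).trace = star ψ ⬝ᵥ ψ := by
  simp only [Matrix.trace, Matrix.diag_apply, Matrix.mul_apply, Matrix.conjTranspose_apply,
    coeffMatrix, dotProduct, Fintype.sum_prod_type, Pi.star_apply, mul_comm]

theorem star_dotProduct_self_eq_ofReal (w : m × n → ℂ) :
    star w ⬝ᵥ w = ((∑ p, ‖w p‖ ^ 2 : ℝ) : ℂ) := by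
  simp only [dotProduct, Pi.star_apply, Complex.ofReal_sum]
  refine Finset.sum_congr rfl fun p _ => ?_
  rw [RCLike.star_def, Complex.conj_mul', Complex.ofReal_pow]

variable [DecidableEq m]

theorem sum_eigenvalues_coeffMatrix {ψ : m × n → ℂ} (hψ : star ψ ⬝ᵥ ψ = 1) :
    ∑ i, (Matrix.isHermitian_mul_conjTranspose_self (coeffMatrix ψ)).eigenvalues i = 1 := by
  have h := (Matrix.isHermitian_mul_conjTranspose_self (coeffMatrix ψ)).trace_eq_sum_eigenvalues
  rw [trace_coeffMatrix_mul_conjTranspose, hψ] at h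
  rw [← Complex.ofReal_inj, Complex.ofReal_sum, Complex.ofReal_one]
  exact h.symm

theorem eigenvalues_coeffMatrix_nonneg (ψ : m × n → ℂ) (i : m) :
    0 ≤ (Matrix.isHermitian_mul_conjTranspose_self (coeffMatrix ψ)).eigenvalues i :=
  (Matrix.posSemidef_self_mul_conjTranspose (coeffMatrix ψ)).eigenvalues_nonneg i

theorem entanglementEntropy_nonneg {ψ : m × n → ℂ} (hψ : star ψ ⬝ᵥ ψ = 1) :
    0 ≤ entanglementEntropy ψ := by
  refine Finset.sum_nonneg fun i _ => div_nonneg (Real.negMulLog_nonneg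
    (eigenvalues_coeffMatrix_nonneg ψ i) ?_) (Real.log_nonneg one_le_two)
  rw [← sum_eigenvalues_coeffMatrix hψ]
  exact Finset.single_le_sum (fun j _ => eigenvalues_coeffMatrix_nonneg ψ j) (Finset.mem_univ i)

/-- The entanglement entropy is at most the Schmidt measure. -/
theorem entanglementEntropy_le_schmidtMeasure {ψ : m × n → ℂ} (hψ : star ψ ⬝ᵥ ψ = 1) :
    entanglementEntropy ψ ≤ schmidtMeasure ψ := by
  have h := sum_negMulLog_le_log_card _ (eigenvalues_coeffMatrix_nonneg ψ)
    (sum_eigenvalues_coeffMatrix hψ)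
  rw [← Matrix.IsHermitian.rank_eq_card_non_zero_eigs, Matrix.rank_self_mul_conjTranspose] at h
  rw [entanglementEntropy, ← Finset.sum_div, schmidtMeasure, Real.logb]
  gcongr

theorem logb_two_natCast_le {k l : ℕ} (h : k ≤ l + 1) :
    Real.logb 2 (k : ℝ) ≤ Real.logb 2 ((l : ℝ) + 1) := by
  -- For k = 0 the default `Real.logb 2 0 = 0` is harmless.
  rcases Nat.eq_zero_or_pos k with rfl | hk
  · simpa using Real.logb_nonneg one_lt_two (by simp)
  · exact Real.logb_le_logb_of_le one_lt_two (by exact_mod_cast hk) (by exact_mod_cast h)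

/-- If a state is a sum of (unnormalized) pure states of Schmidt rank at most `r + 1`, its
entanglement of formation is at most `log₂ (r + 1)`. -/
theorem entanglementOfFormation_le {ι : Type*} [Fintype ι] [Nonempty (m × n)]
    (w : ι → m × n → ℂ) (r : ℕ) (hrank : ∀ i, (coeffMatrix (w i)).rank ≤ r + 1)
    (htr : (∑ i, Matrix.vecMulVec (w i) (star (w i))).trace = 1) :
    entanglementOfFormation (∑ i, Matrix.vecMulVec (w i) (star (w i))) ≤
      Real.logb 2 ((r : ℝ) + 1) := by
  classical
  set p : ι → ℝ := fun i => ∑ x, ‖w i x‖ ^ 2 with hp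
  have hp0 : ∀ i, 0 ≤ p i := fun i => Finset.sum_nonneg fun x _ => by positivity
  have hpw : ∀ i, star (w i) ⬝ᵥ w i = (p i : ℂ) := fun i => star_dotProduct_self_eq_ofReal (w i)
  have hpsum : ∑ i, p i = 1 := by
    rw [Matrix.trace_sum] at htr
    simp only [Matrix.trace_vecMulVec, dotProduct_comm (w _), hpw] at htr
    exact_mod_cast htr
  have hψ : ∀ i, ∃ ψ : m × n → ℂ, star ψ ⬝ᵥ ψ = 1 ∧
      (p i : ℂ) • Matrix.vecMulVec ψ (star ψ) = Matrix.vecMulVec (w i) (star (w i)) ∧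
      p i * entanglementEntropy ψ ≤ p i * Real.logb 2 ((r : ℝ) + 1) := by
    intro i
    by_cases h0 : p i = 0
    · obtain ⟨x₀⟩ := ‹Nonempty (m × n)›
      have hw : w i = 0 := by
        have h1 := hpw i
        rw [h0, Complex.ofReal_zero] at h1
        exact dotProduct_star_self_eq_zero.mp h1
      -- A component of weight zero still needs some unit vector; any basis vector serves.
      refine ⟨fun x => if x = x₀ then 1 else 0, ?_, by simp [h0, hw], by simp [h0]⟩
      simp [dotProduct]
    · set c : ℂ := (((Real.sqrt (p i))⁻¹ : ℝ) : ℂ) with hc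
      have hcc : star c * c = (((p i)⁻¹ : ℝ) : ℂ) := by
        rw [hc, RCLike.star_def, Complex.conj_ofReal, ← Complex.ofReal_mul, ← mul_inv,
          Real.mul_self_sqrt (hp0 i)]
      have hpc : (p i : ℂ) * (star c * c) = 1 := by
        rw [hcc, ← Complex.ofReal_mul, mul_inv_cancel₀ h0, Complex.ofReal_one]
      have hunit : star (c • w i) ⬝ᵥ (c • w i) = 1 := by
        rw [star_smul, smul_dotProduct, dotProduct_smul, hpw, smul_eq_mul, smul_eq_mul, ← hpc]
        ring
      refine ⟨c • w i, hunit, ?_, ?_⟩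
      · rw [star_smul, Matrix.smul_vecMulVec, Matrix.vecMulVec_smul, smul_smul, smul_smul,
          mul_assoc, mul_comm c, hpc, one_smul]
      · refine mul_le_mul_of_nonneg_left ?_ (hp0 i)
        refine (entanglementEntropy_le_schmidtMeasure hunit).trans (logb_two_natCast_le ?_)
        refine le_trans ?_ (hrank i)
        have : coeffMatrix (c • w i) = c • coeffMatrix (w i) := rfl
        rw [this, Matrix.smul_eq_diagonal_mul]
        exact Matrix.rank_mul_le_right _ _
  choose ψ hψ1 hψ2 hψ3 using hψ
  -- The infimum is bounded by a member of the set only once the set is bounded below.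
  have hbdd : BddBelow {s : ℝ | ∃ (k : ℕ) (q : Fin k → ℝ) (φ : Fin k → m × n → ℂ),
      (∀ i, 0 ≤ q i) ∧ ∑ i, q i = 1 ∧ (∀ i, star (φ i) ⬝ᵥ φ i = 1) ∧
      ∑ i, Matrix.vecMulVec (w i) (star (w i)) =
        ∑ i, (q i : ℂ) • Matrix.vecMulVec (φ i) (star (φ i)) ∧
      s = ∑ i, q i * entanglementEntropy (φ i)} := by
    refine ⟨0, ?_⟩
    rintro _ ⟨k, q, φ, hq, -, hφ, -, rfl⟩
    exact Finset.sum_nonneg fun i _ => mul_nonneg (hq i) (entanglementEntropy_nonneg (hφ i))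
  let e := Fintype.equivFin ι
  refine (csInf_le hbdd ⟨Fintype.card ι, p ∘ e.symm, ψ ∘ e.symm, fun i => hp0 _, ?_,
    fun i => hψ1 _, ?_, rfl⟩).trans ?_
  · rw [← hpsum]
    exact e.symm.sum_comp p
  · simp only [Function.comp_apply, hψ2]
    exact (e.symm.sum_comp fun i => Matrix.vecMulVec (w i) (star (w i))).symm
  · calc ∑ i, (p ∘ e.symm) i * entanglementEntropy ((ψ ∘ e.symm) i)
        = ∑ i, p i * entanglementEntropy (ψ i) :=
          e.symm.sum_comp fun i => p i * entanglementEntropy (ψ i)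
      _ ≤ ∑ i, p i * Real.logb 2 ((r : ℝ) + 1) := Finset.sum_le_sum fun i _ => hψ3 i
      _ = Real.logb 2 ((r : ℝ) + 1) := by rw [← Finset.sum_mul, hpsum, one_mul]

end Entropy

/-! ### Reductions of the ground space -/

section Reductions

variable {V : Type*} [DecidableEq V]

/-- Disjointness gives injectivity: on an overlap the values of the C-part would be overridden by
those of the A-part. -/
theorem glue_bijective {A C : Finset V} (hAC : Disjoint A C) :
    Function.Bijective fun q : ((A → Fin 2) × (C → Fin 2)) × ({v : V // v ∉ A ∧ v ∉ C} → Fin 2) =>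
      glue A C q.1 q.2 := by
  constructor
  · rintro ⟨⟨x, y⟩, z⟩ ⟨⟨x', y'⟩, z'⟩ h
    have h' : ∀ v, glue A C (x, y) z v = glue A C (x', y') z' v := congrFun h
    refine Prod.ext (Prod.ext ?_ ?_) ?_
    · ext ⟨v, hv⟩
      have := h' v
      simp only [glue, hv, dif_pos] at this
      simp [this]
    · ext ⟨v, hv⟩
      have := h' v
      have hvA : v ∉ A := Finset.disjoint_right.mp hAC hv
      simp only [glue, hv, hvA, dif_pos, dif_neg, not_false_eq_true] at this
      simp [this]
    · ext ⟨v, hv⟩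
      have := h' v
      simp only [glue, hv.1, hv.2, dif_neg, not_false_eq_true] at this
      simp [this]
  · intro x
    refine ⟨((fun v => x v, fun v => x v), fun v => x v), ?_⟩
    ext v
    simp only [glue]
    split_ifs <;> rfl

variable [Fintype V]

open scoped MatrixOrder Matrix.Norms.L2Operator in
/-- A state on `M` is a sum of unnormalized pure states of `M`. -/
theorem IsStateOn.exists_eq_sum {M : Submodule ℂ ((V → Fin 2) → ℂ)}
    {ρ : Matrix (V → Fin 2) (V → Fin 2) ℂ} (h : IsStateOn M ρ) :
    ∃ v : (V → Fin 2) → (V → Fin 2) → ℂ, (∀ k, v k ∈ M) ∧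
      ρ = ∑ k, Matrix.vecMulVec (v k) (star (v k)) := by
  obtain ⟨B, hB⟩ := CStarAlgebra.nonneg_iff_eq_star_mul_self.mp h.posSemidef.nonneg
  rw [Matrix.star_eq_conjTranspose] at hB
  -- With ρ = B*B, the columns of B* are the pure states sought. They lie in M because B* and ρ have
  -- equal rank, hence equal range.
  have hle : LinearMap.range ρ.mulVecLin ≤ LinearMap.range B.conjTranspose.mulVecLin := by
    rw [hB, Matrix.mulVecLin_mul]
    exact LinearMap.range_comp_le_range _ _
  have hrange : LinearMap.range ρ.mulVecLin = LinearMap.range B.conjTranspose.mulVecLin := by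
    refine Submodule.eq_of_le_of_finrank_eq hle ?_
    change ρ.rank = B.conjTranspose.rank
    rw [hB, Matrix.rank_conjTranspose_mul_self, Matrix.rank_conjTranspose]
  refine ⟨fun k x => B.conjTranspose x k, fun k => ?_, ?_⟩
  · have hk : (fun x => B.conjTranspose x k) ∈ LinearMap.range ρ.mulVecLin := by
      rw [hrange]
      exact ⟨Pi.single k 1, by ext x; simp⟩
    obtain ⟨φ, hφ⟩ := hk
    have hmem := h.support φ
    rw [← Matrix.mulVecLin_apply, hφ] at hmem
    exact hmem
  · ext x y
    rw [hB, Matrix.sum_apply]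
    simp [Matrix.mul_apply, Matrix.vecMulVec_apply]

theorem trace_reducedState {A C : Finset V} (hAC : Disjoint A C)
    (ρ : Matrix (V → Fin 2) (V → Fin 2) ℂ) : (reducedState A C ρ).trace = ρ.trace := by
  simp only [Matrix.trace, Matrix.diag_apply, reducedState]
  rw [← Fintype.sum_prod_type']
  exact (glue_bijective hAC).sum_comp fun x => ρ x x

/-- Each configuration z of the traced-out spins contributes one slice of each vector. -/
theorem reducedState_sum_vecMulVec {ι : Type*} [Fintype ι] (A C : Finset V)
    (v : ι → (V → Fin 2) → ℂ) :
    reducedState A C (∑ k, Matrix.vecMulVec (v k) (star (v k))) =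
      ∑ q : ι × ({v : V // v ∉ A ∧ v ∉ C} → Fin 2),
        Matrix.vecMulVec (fun p => v q.1 (glue A C p q.2))
          (star fun p => v q.1 (glue A C p q.2)) := by
  ext p p'
  simp only [reducedState, Matrix.sum_apply, Matrix.vecMulVec_apply, Pi.star_apply,
    Fintype.sum_prod_type]
  exact Finset.sum_comm

theorem range_coeffMatrix_le_reducedSpace {A : Finset V} {M : Submodule ℂ ((V → Fin 2) → ℂ)}
    {Φ : (V → Fin 2) → ℂ} (hΦ : Φ ∈ M) :
    LinearMap.range (coeffMatrix (cut A Φ)).mulVecLin ≤ reducedSpace A M :=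
  le_iSup₂_of_le Φ hΦ le_rfl

theorem rank_coeffMatrix_cut_le {A : Finset V} {M : Submodule ℂ ((V → Fin 2) → ℂ)}
    {Φ : (V → Fin 2) → ℂ} (hΦ : Φ ∈ M) :
    (coeffMatrix (cut A Φ)).rank ≤ Module.finrank ℂ (reducedSpace A M) :=
  Submodule.finrank_mono (range_coeffMatrix_le_reducedSpace hΦ)

/-- Fixing the spins outside `A ∪ C` selects columns of the coefficient matrix. -/
theorem rank_coeffMatrix_glue_le {A C : Finset V} {M : Submodule ℂ ((V → Fin 2) → ℂ)}
    {Φ : (V → Fin 2) → ℂ} (hΦ : Φ ∈ M)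
    (z : {v : V // v ∉ A ∧ v ∉ C} → Fin 2) :
    (coeffMatrix fun p : (A → Fin 2) × (C → Fin 2) => Φ (glue A C p z)).rank ≤
      Module.finrank ℂ (reducedSpace A M) := by
  refine le_trans ?_ (rank_coeffMatrix_cut_le (A := A) hΦ)
  have h : (coeffMatrix fun p : (A → Fin 2) × (C → Fin 2) => Φ (glue A C p z)) =
      (coeffMatrix (cut A Φ)).submatrix id
        (fun y v => if hC : v.1 ∈ C then y ⟨v, hC⟩ else z ⟨v, v.2, hC⟩) := rfl
  rw [h, Matrix.rank, Matrix.rank]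
  refine Submodule.finrank_mono ?_
  rw [Matrix.range_mulVecLin, Matrix.range_mulVecLin]
  refine Submodule.span_mono ?_
  rintro _ ⟨y, rfl⟩
  exact ⟨_, rfl⟩

end Reductions

/-! ### Entanglement bounds for natural frustration-free Hamiltonians -/

namespace PairHamiltonian

variable {V : Type*}

/-- The number of heavy components is at most one if all terms are heavy. -/
theorem heavyComponents_le_one {H : PairHamiltonian V} {A : Finset V} (hA : H.IsContiguous A)
    (hheavy : ∀ a b, H.term a b ≠ 0 → (H.term a b).rank = 2 ∨ (H.term a b).rank = 3) :
    H.heavyComponents A ≤ 1 := by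
  have hle : (H.restrict A).interactionGraph ≤ (H.restrict A).heavyGraph :=
    fun a b hab => hheavy a b hab
  have := (hA.mono hle).subsingleton_connectedComponent
  exact Finite.card_le_one_iff_subsingleton.mpr this

variable [DecidableEq V]

/-- The terms of H_A are terms of H and inherit their properties; contiguity supplies the
connectedness. -/
theorem finrank_ker_restrict_le {H : PairHamiltonian V} (hnat : H.IsNatural) {A : Finset V}
    (hA : H.IsContiguous A) :
    Module.finrank ℂ (LinearMap.ker (H.restrict A).op.mulVecLin) ≤ H.heavyComponents A + 1 :=
  (H.restrict A).finrank_ker_op_le (fun a b => hnat.posSemidef a b) hA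
    fun a b => hnat.entangled_excited a b

variable [Fintype V]

/-- For a frustration-free Hamiltonian, the reductions to `A` of the ground states are in the
kernel of `H_A`. -/
theorem reducedSpace_groundSpace_le {H : PairHamiltonian V} (hnat : H.IsNatural)
    (hff : H.IsFrustrationFree) (A : Finset V) :
    reducedSpace A H.groundSpace ≤ LinearMap.ker (H.restrict A).op.mulVecLin := by
  refine iSup₂_le fun Φ hΦ => ?_
  rw [Matrix.range_mulVecLin, Submodule.span_le]
  -- A column is Φ with the spins outside A frozen at y, and terms inside A act on it as on Φ.
  rintro _ ⟨y, rfl⟩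
  rw [SetLike.mem_coe, LinearMap.mem_ker, Matrix.mulVecLin_apply,
    (H.restrict A).op_mulVec_eq_zero_iff fun a b => hnat.posSemidef a b]
  intro a b
  by_cases hab : a = b
  · subst hab
    rw [embedPair_term_self, Matrix.zero_mulVec]
  rw [embedPair_mulVec_eq_zero_iff hab]
  intro x
  have h := (embedPair_mulVec_eq_zero_iff (fun h => hab (Subtype.ext h)) _ Φ).mp (hff Φ hΦ a b)
    (fun v => if h : v ∈ A then x ⟨v, h⟩ else y ⟨v, h⟩)
  convert h using 1
  refine congrArg _ (funext fun p => congrArg Φ (funext fun v => ?_))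
  by_cases hv : v ∈ A
  · simp only [hv, dif_pos, Function.update_apply, Subtype.ext_iff]
  · have hva : v ≠ a := fun h => hv (h ▸ a.2)
    have hvb : v ≠ b := fun h => hv (h ▸ b.2)
    simp [hv, hva, hvb]

theorem entanglement_bounds {H : PairHamiltonian V} (hnat : H.IsNatural)
    (hff : H.IsFrustrationFree) {A : Finset V} (hA : H.IsContiguous A) {β : ℕ}
    (hβ : H.heavyComponents A ≤ β) :
    Real.logb 2 (Module.finrank ℂ (LinearMap.ker (H.restrict A).op.mulVecLin))
        ≤ Real.logb 2 (β + 1) ∧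
    Real.logb 2 (Module.finrank ℂ (reducedSpace A H.groundSpace)) ≤ Real.logb 2 (β + 1) ∧
    (∀ Φ ∈ H.groundSpace, schmidtMeasure (cut A Φ) ≤ Real.logb 2 (β + 1)) ∧
    (∀ ρ, IsStateOn H.groundSpace ρ → ∀ C : Finset V, Disjoint A C →
      entanglementOfFormation (reducedState A C ρ) ≤ Real.logb 2 (β + 1)) := by
  have hker : Module.finrank ℂ (LinearMap.ker (H.restrict A).op.mulVecLin) ≤ β + 1 :=
    (finrank_ker_restrict_le hnat hA).trans (Nat.add_le_add_right hβ 1)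
  have hred : Module.finrank ℂ (reducedSpace A H.groundSpace) ≤ β + 1 :=
    (Submodule.finrank_mono (reducedSpace_groundSpace_le hnat hff A)).trans hker
  refine ⟨logb_two_natCast_le hker, logb_two_natCast_le hred,
    fun Φ hΦ => logb_two_natCast_le ((rank_coeffMatrix_cut_le hΦ).trans hred), ?_⟩
  intro ρ hρ C hAC
  -- Slices of the ground vectors decomposing ρ decompose its reduced state, with Schmidt rank at
  -- most β + 1.
  obtain ⟨v, hv, hsum⟩ := hρ.exists_eq_sum
  have htr : (reducedState A C ρ).trace = 1 := (trace_reducedState hAC ρ).trans hρ.trace_one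
  rw [hsum, reducedState_sum_vecMulVec] at htr ⊢
  exact entanglementOfFormation_le _ β
    (fun q => (rank_coeffMatrix_glue_le (hv q.1) q.2).trans hred) htr

end PairHamiltonian

theorem mainTheorem5 {V : Type*} [Fintype V] [DecidableEq V] (H : PairHamiltonian V)
    (hnat : H.IsNatural) (hff : H.IsFrustrationFree)
    (A : Finset V) (hA : H.IsContiguous A) :
    (∀ β : ℕ, H.heavyComponents A ≤ β →
      Real.logb 2 (Module.finrank ℂ (LinearMap.ker (H.restrict A).op.mulVecLin))
          ≤ Real.logb 2 (β + 1) ∧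
      Real.logb 2 (Module.finrank ℂ (reducedSpace A H.groundSpace)) ≤ Real.logb 2 (β + 1) ∧
      (∀ Φ ∈ H.groundSpace, schmidtMeasure (cut A Φ) ≤ Real.logb 2 (β + 1)) ∧
      (∀ ρ, IsStateOn H.groundSpace ρ → ∀ C : Finset V, Disjoint A C →
        entanglementOfFormation (reducedState A C ρ) ≤ Real.logb 2 (β + 1))) ∧
    ((∀ a b, H.term a b ≠ 0 → (H.term a b).rank = 2 ∨ (H.term a b).rank = 3) →
      Real.logb 2 (Module.finrank ℂ (LinearMap.ker (H.restrict A).op.mulVecLin)) ≤ 1 ∧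
      Real.logb 2 (Module.finrank ℂ (reducedSpace A H.groundSpace)) ≤ 1 ∧
      (∀ Φ ∈ H.groundSpace, schmidtMeasure (cut A Φ) ≤ 1) ∧
      (∀ ρ, IsStateOn H.groundSpace ρ → ∀ C : Finset V, Disjoint A C →
        entanglementOfFormation (reducedState A C ρ) ≤ 1)) := by
  refine ⟨fun β hβ => PairHamiltonian.entanglement_bounds hnat hff hA hβ, fun hheavy => ?_⟩
  have h := PairHamiltonian.entanglement_bounds hnat hff hA
    (PairHamiltonian.heavyComponents_le_one hA hheavy)
  have h2 : Real.logb 2 (((1 : ℕ) : ℝ) + 1) = 1 := by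
    rw [Nat.cast_one, one_add_one_eq_two, Real.logb_self_eq_one one_lt_two]
  simpa only [h2] using h
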